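/- Let $m>0$, $q\ge 0$, and let $W:\mathbb R\to\mathbb R$ be a $C^2$ function such that $W\ge 0$, $W(0)=W'(0)=0$, $W''(0)=m^2$ and, writing $W(s)=\tfrac12 m^2s^2+N(s)$, there is $s_0>0$ with $N(s_0)<0$, and $|N'(s)|\le c_1|s|^{r-1}+c_2|s|^{p-1}$ for all $s\in\mathbb R$, with some constants $c_1,c_2$ and exponents $r,p\in(2,6)$. Let $\mathcal H=H^1(\mathbb R^3)\times L^2(\mathbb R^3)^{11}$ be the space of all $\mathbf u=(u,\hat u,\theta,\Theta,\mathbf E,\mathbf H)$ ($u,\hat u,\theta$ scalar, $\Theta,\mathbf E,\mathbf H$ with values in $\mathbb R^3$), with norm $\|\mathbf u\|^2=\int(\hat u^2+|\nabla u|^2+m^2u^2+\theta^2+|\Theta|^2+|\mathbf E|^2+|\mathbf H|^2)\,dx$, and let the phase space of the Klein-Gordon-Maxwell system be $$X=\{\mathbf u\in\mathcal H:\ \nabla\cdot\mathbf E=q\theta u,\ \nabla\cdot\mathbf H=0\}$$ (divergences in the sense of distributions). Put $E(\mathbf u)=\tfrac12\|\mathbf u\|^2+\int N(u)\,dx$ (energy)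 and $C(\mathbf u)=\int\theta u\,dx$ (charge). Let $\gamma_t:X\to X$ $(t\in\mathbb R)$ be the time evolution (in particular that of the nonlinear Klein-Gordon-Maxwell system; no property of $\gamma$ is required other than those in the next definition). A state $\mathbf u_0\in X$ is a *standing hylomorphic soliton* if there are $e_0,c_0\in\mathbb R$ with $e_0=\min\{E(\mathbf u):\mathbf u\in X,\ |C(\mathbf u)|=c_0\}$ such that the set $\Gamma=\{\mathbf u\in X: E(\mathbf u)=e_0,\ |C(\mathbf u)|=c_0\}$ contains $\mathbf u_0$, does not contain $0$, is invariant ($\gamma_t\Gamma\subset\Gamma$ for all $t$), is stable (for every $\varepsilon>0$ there is $\delta>0$ such that $d(\mathbf u,\Gamma)\le\delta$ implies $d(\gamma_t\mathbf u,\Gamma)\le\varepsilon$ for all $t\ge0$), and is compact up to translations (every sequence $\mathbf u_n$ in $\Gamma$ has a subsequence $\mathbf u_{n_k}$ such that, for some $\tau_k\in\mathbb R^3$, $\mathbf u_{n_k}(\cdot-\tau_k)$ converges in $X$). **Theorem.** Every standing hylomorphic soliton $\mathbf u=(u,\hat u,\theta,\Theta,\mathbf E,\mathbf H)$ is stationary: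 $\hat u=0$, $\Theta=0$, $\mathbf H=0$, and there is $\varphi\in\mathcal D^{1,2}(\mathbb R^3)$ (the closure of $C_c^\infty(\mathbb R^3)$ for the norm $\|\nabla\varphi\|_{L^2}$) with $\mathbf E=-\nabla\varphi$, such that $u,\theta,\varphi$ are weak solutions on $\mathbb R^3$ of $$-\Delta u+W'(u)-\frac{\theta^2}{u}=0,\qquad -\Delta\varphi=q\theta u .$$ Moreover $\theta=0$ almost everywhere on $\{u=0\}$, and $\theta^2/u$ is understood as $0$ there. -/

import Mathlib

open MeasureTheory Filter Topology
open scoped ContDiff Gradient RealInnerProductSpace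

noncomputable section

namespace NKGM

/-- Physical space, with its Euclidean norm. -/
abbrev R3 : Type := EuclideanSpace ℝ (Fin 3)

/-- Real-valued square integrable functions on `ℝ³`. -/
abbrev L2 : Type := Lp ℝ 2 (volume : Measure R3)

/-- Vector-valued square integrable functions on `ℝ³`. -/
abbrev L2Vec : Type := Lp R3 2 (volume : Measure R3)

/-! ### Weak derivatives -/

/-- Test functions: `C_c^∞(ℝ³)`. -/
def IsTest (η : R3 → ℝ) : Prop := ContDiff ℝ ∞ η ∧ HasCompactSupport η

/-- `G` is the weak gradient of `f`: `∫ f ∇η = - ∫ η G` for all test functions `η`. -/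
def IsWeakGradient (f : R3 → ℝ) (G : R3 → R3) : Prop :=
  LocallyIntegrable f ∧ LocallyIntegrable G ∧
    ∀ η : R3 → ℝ, IsTest η → ∫ x, f x • ∇ η x = - ∫ x, η x • G x

/-- `∇ · F = f` in the sense of distributions. -/
def IsWeakDivergence (F : R3 → R3) (f : R3 → ℝ) : Prop :=
  LocallyIntegrable F ∧ LocallyIntegrable f ∧
    ∀ η : R3 → ℝ, IsTest η → ∫ x, ⟪F x, ∇ η x⟫ = - ∫ x, f x * η x

/-- `f` is a weak solution of `-Δ f + h = 0` on `ℝ³`. -/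
def WeaklySolves (f h : R3 → ℝ) : Prop :=
  LocallyIntegrable h ∧ ∃ G : R3 → R3, IsWeakGradient f G ∧
    ∀ η : R3 → ℝ, IsTest η → (∫ x, ⟪G x, ∇ η x⟫) + ∫ x, h x * η x = 0

/-- `f ∈ 𝒟^{1,2}(ℝ³)`, the closure of the test functions for the norm `‖∇f‖_{L²}`, realised as a
space of functions through the Sobolev embedding in `L⁶`: some sequence of test functions converges
to `f` in `L⁶` and has gradients converging in `L²`. -/
def MemD12 (f : R3 → ℝ) : Prop :=
  MemLp f 6 ∧ ∃ G : R3 → R3, MemLp G 2 ∧ ∃ η : ℕ → R3 → ℝ, (∀ n, IsTest (η n)) ∧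
    Tendsto (fun n => eLpNorm (fun x => η n x - f x) 6) atTop (𝓝 0) ∧
    Tendsto (fun n => eLpNorm (fun x => ∇ (η n) x - G x) 2) atTop (𝓝 0)

/-! ### The potential -/

/-- The nonlinear part `N` of the potential, `W(s) = m² s² / 2 + N(s)`. -/
def nonlin (W : ℝ → ℝ) (m : ℝ) (s : ℝ) : ℝ := W s - 1 / 2 * m ^ 2 * s ^ 2

/-- The assumptions (W-0) -- (W-iii) on the potential. -/
structure IsAdmissible (W : ℝ → ℝ) (m : ℝ) : Prop where
  nonneg : ∀ s, 0 ≤ W s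
  contDiff : ContDiff ℝ 2 W
  zero : W 0 = 0
  deriv_zero : deriv W 0 = 0
  mass_pos : 0 < m
  deriv2_zero : deriv (deriv W) 0 = m ^ 2
  hylomorphy : ∃ s₀ > 0, nonlin W m s₀ < 0
  growth : ∃ c₁ c₂ r p : ℝ, r ∈ Set.Ioo (2 : ℝ) 6 ∧ p ∈ Set.Ioo (2 : ℝ) 6 ∧
    ∀ s, |deriv (nonlin W m) s| ≤ c₁ * |s| ^ (r - 1) + c₂ * |s| ^ (p - 1)

/-! ### The phase space -/

/-- The space `ℋ` of the configurations `(u, û, θ, Θ, E, H) ∈ H¹(ℝ³) × L²(ℝ³)¹¹`. The `H¹` function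
`u` is recorded together with its (unique) weak gradient `gradU`. -/
structure Config where
  u : L2
  gradU : L2Vec
  isWeakGradient : IsWeakGradient u gradU
  uHat : L2
  theta : L2
  Theta : L2Vec
  E : L2Vec
  H : L2Vec

/-- The zero configuration. -/
instance : Zero Config where
  zero :=
    { u := 0, gradU := 0, uHat := 0, theta := 0, Theta := 0, E := 0, H := 0
      isWeakGradient := by
        refine ⟨(Lp.memLp _).locallyIntegrable (by norm_num),
          (Lp.memLp _).locallyIntegrable (by norm_num), fun η _ => ?_⟩
        simp }

/-- The distance of `ℋ`, given by the norm
`‖u‖² = ∫ (û² + |∇u|² + m² u² + θ² + |Θ|² + |E|² + |H|²)`. -/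
def dist (m : ℝ) (z w : Config) : ℝ :=
  √(‖z.uHat - w.uHat‖ ^ 2 + ‖z.gradU - w.gradU‖ ^ 2 + m ^ 2 * ‖z.u - w.u‖ ^ 2
    + ‖z.theta - w.theta‖ ^ 2 + ‖z.Theta - w.Theta‖ ^ 2 + ‖z.E - w.E‖ ^ 2 + ‖z.H - w.H‖ ^ 2)

/-- The energy `½ ∫ (û² + |∇u|² + m² u² + θ² + |Θ|² + |E|² + |H|²) + ∫ N(u)`. -/
def energy (W : ℝ → ℝ) (m : ℝ) (z : Config) : ℝ :=
  1 / 2 * (‖z.uHat‖ ^ 2 + ‖z.gradU‖ ^ 2 + m ^ 2 * ‖z.u‖ ^ 2 + ‖z.theta‖ ^ 2 + ‖z.Theta‖ ^ 2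
    + ‖z.E‖ ^ 2 + ‖z.H‖ ^ 2) + ∫ x, nonlin W m (z.u x)

/-- The (hylenic) charge `∫ θ u`. -/
def charge (z : Config) : ℝ := ∫ x, z.theta x * z.u x

/-- The phase space `X = {z ∈ ℋ : ∇ · E = q θ u, ∇ · H = 0}`. -/
def PhaseSpace (q : ℝ) : Type :=
  {z : Config // IsWeakDivergence z.E (fun x => q * z.theta x * z.u x) ∧
    IsWeakDivergence z.H (fun _ => 0)}

/-- The zero state. -/
instance (q : ℝ) : Zero (PhaseSpace q) where
  zero :=
    ⟨0, by
      have hL : LocallyIntegrable (0 : L2Vec) (volume : Measure R3) :=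
        (Lp.memLp _).locallyIntegrable (by norm_num)
      have h0 : LocallyIntegrable (fun _ => (0 : ℝ)) (volume : Measure R3) :=
        (integrable_zero R3 ℝ volume).locallyIntegrable
      change IsWeakDivergence (0 : L2Vec) (fun x => q * (0 : L2) x * (0 : L2) x) ∧
        IsWeakDivergence (0 : L2Vec) (fun _ => 0)
      refine ⟨⟨hL, ?_, fun η _ => ?_⟩, hL, h0, fun η _ => ?_⟩
      · simpa using h0
      · simp
      · simp⟩

/-! ### Translations -/

/-- The map `x ↦ x + τ` preserves Lebesgue measure. -/
theorem measurePreserving_shift (τ : R3) :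
    MeasurePreserving (fun x : R3 => x + τ) volume volume :=
  measurePreserving_add_right volume τ

/-- `(T_τ z)(x) = z(x + τ)`. -/
def translate (τ : R3) (z : Config) : Config where
  u := Lp.compMeasurePreserving (fun x => x + τ) (measurePreserving_shift τ) z.u
  gradU := Lp.compMeasurePreserving (fun x => x + τ) (measurePreserving_shift τ) z.gradU
  uHat := Lp.compMeasurePreserving (fun x => x + τ) (measurePreserving_shift τ) z.uHat
  theta := Lp.compMeasurePreserving (fun x => x + τ) (measurePreserving_shift τ) z.theta
  Theta := Lp.compMeasurePreserving (fun x => x + τ) (measurePreserving_shift τ) z.Theta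
  E := Lp.compMeasurePreserving (fun x => x + τ) (measurePreserving_shift τ) z.E
  H := Lp.compMeasurePreserving (fun x => x + τ) (measurePreserving_shift τ) z.H
  isWeakGradient := by
    refine ⟨(Lp.memLp _).locallyIntegrable (by norm_num),
      (Lp.memLp _).locallyIntegrable (by norm_num), fun η hη => ?_⟩
    have hu := Lp.coeFn_compMeasurePreserving z.u (measurePreserving_shift τ)
    have hG := Lp.coeFn_compMeasurePreserving z.gradU (measurePreserving_shift τ)
    have hη' : IsTest (fun y => η (y - τ)) :=
      ⟨hη.1.comp (contDiff_id.sub contDiff_const),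
        hη.2.comp_homeomorph (Homeomorph.subRight τ)⟩
    have hgrad : ∀ x : R3, ∇ (fun y => η (y - τ)) (x + τ) = ∇ η x := fun x => by
      simp only [gradient, fderiv_comp_sub, add_sub_cancel_right]
    have key := z.isWeakGradient.2.2 _ hη'
    rw [← integral_add_right_eq_self (fun x => z.u x • ∇ (fun y => η (y - τ)) x) τ,
      ← integral_add_right_eq_self (fun x => η (x - τ) • z.gradU x) τ] at key
    simp only [hgrad, add_sub_cancel_right] at key
    rw [integral_congr_ae (g := fun x => z.u (x + τ) • ∇ η x)
        (by filter_upwards [hu] with x hx; rw [hx]; rfl),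
      integral_congr_ae (f := fun x => η x • _) (g := fun x => η x • z.gradU (x + τ))
        (by filter_upwards [hG] with x hx; rw [hx]; rfl)]
    exact key

/-! ### Solitons -/

/-- The distance of a state from a set of states. -/
def distTo (m : ℝ) {q : ℝ} (z : PhaseSpace q) (Γ : Set (PhaseSpace q)) : ℝ :=
  ⨅ w : Γ, dist m z.1 w.1.1

/-- `Γ` is invariant under the evolution map `γ`. -/
def IsInvariant {q : ℝ} (γ : ℝ → PhaseSpace q → PhaseSpace q) (Γ : Set (PhaseSpace q)) : Prop :=
  ∀ z ∈ Γ, ∀ t, γ t z ∈ Γ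

/-- `Γ` is (Lyapunov) stable under the evolution map `γ`. -/
def IsStable (m : ℝ) {q : ℝ} (γ : ℝ → PhaseSpace q → PhaseSpace q)
    (Γ : Set (PhaseSpace q)) : Prop :=
  ∀ ε > 0, ∃ δ > 0, ∀ z : PhaseSpace q, distTo m z Γ ≤ δ → ∀ t ≥ 0, distTo m (γ t z) Γ ≤ ε

/-- `Γ` is compact up to space translations. -/
def IsTranslationCompact (m : ℝ) {q : ℝ} (Γ : Set (PhaseSpace q)) : Prop :=
  ∀ z : ℕ → PhaseSpace q, (∀ n, z n ∈ Γ) →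
    ∃ k : ℕ → ℕ, StrictMono k ∧ ∃ (τ : ℕ → R3) (w : PhaseSpace q),
      Tendsto (fun n => dist m (translate (-τ n) (z (k n)).1) w.1) atTop (𝓝 0)

/-- The set `Γ(e₀, c₀) = {z ∈ X : E(z) = e₀, |C(z)| = c₀}`. -/
def levelSet (W : ℝ → ℝ) (m q e₀ c₀ : ℝ) : Set (PhaseSpace q) :=
  {z | energy W m z.1 = e₀ ∧ |charge z.1| = c₀}

/-- `z₀` is a standing hylomorphic soliton of the dynamical system `(X, γ)`: it belongs to some
`Γ = Γ(e₀, c₀)`, where `e₀` is the minimum of the energy among the states with `|C| = c₀`, and `Γ` is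
invariant, stable, compact up to translations and does not contain `0`. -/
def IsStandingHylomorphicSoliton (W : ℝ → ℝ) (m : ℝ) {q : ℝ}
    (γ : ℝ → PhaseSpace q → PhaseSpace q) (z₀ : PhaseSpace q) : Prop :=
  ∃ e₀ c₀ : ℝ,
    IsLeast ((fun z : PhaseSpace q => energy W m z.1) '' {z | |charge z.1| = c₀}) e₀ ∧
    z₀ ∈ levelSet W m q e₀ c₀ ∧
    IsInvariant γ (levelSet W m q e₀ c₀) ∧
    IsStable m γ (levelSet W m q e₀ c₀) ∧
    IsTranslationCompact m (levelSet W m q e₀ c₀) ∧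
    (0 : PhaseSpace q) ∉ levelSet W m q e₀ c₀

end NKGM

end

noncomputable section

namespace NKGM

open scoped NNReal ENNReal Convolution
open ContinuousLinearMap (lsmul)

/-! ### Test functions -/

/-! A soliton minimizes the energy among the states with its value of `|C|`, and the stationary
system is the Euler-Lagrange system of this problem. Replacing `û`, `Θ`, `H` by zero keeps the
constraints and strictly lowers the energy unless they already vanish. The charge is nonzero:
otherwise the zero state would be a competitor, and `E ≥ 0 = E(0)` would place it in `Γ`.

For the other components, take test functions with `ψ ξ = 0` and a field `F` with `∇·F = q(ψ u + θ
ξ)`, and consider `u + tξ`, `s(θ + tψ)`, `s(E + tF)`. Since `ψ ξ = 0`, Gauss's law holds exactly for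
every `t`, and the scalar `s = s(t)` restores the charge. Differentiating the energy at `t = 0`
gives `IsMinimizer.euler_lagrange`, with multiplier `l = (‖θ‖² + ‖E‖²)/C`.

With `ψ = ξ = 0`, `E` is orthogonal to all divergence-free fields, so it lies in the `L²` closure of
gradients and `E = -∇φ` (`exists_potential`). Then `⟪E, F⟫ = ∫ φ ∇·F`, and varying `ψ` and `ξ`
separately gives `θ = (l - qφ)u` and `-Δu + W'(u) = (l - qφ)θ`. The first relation turns the
right-hand side of the second into `θ²/u`; Gauss's law is the equation for `φ`.

The analytic input is the Sobolev inequality. It puts `u` in `L⁶`, which controls the nonlinear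
term, and it provides `F` through Riesz representation, because `ψu` and `θξ` lie in `L^{6/5}`
(`exists_isWeakDivergence`). -/

theorem IsTest.differentiable {η : R3 → ℝ} (h : IsTest η) : Differentiable ℝ η :=
  h.1.differentiable (by simp)

theorem IsTest.zero : IsTest 0 := ⟨contDiff_const, HasCompactSupport.zero⟩

theorem IsTest.add {η ζ : R3 → ℝ} (h : IsTest η) (k : IsTest ζ) : IsTest (η + ζ) :=
  ⟨h.1.add k.1, h.2.add k.2⟩

theorem IsTest.smul {η : R3 → ℝ} (c : ℝ) (h : IsTest η) : IsTest (c • η) :=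
  ⟨h.1.const_smul c, h.2.smul_left (f := fun _ => c)⟩

theorem IsTest.gradient_add {η ζ : R3 → ℝ} (h : IsTest η) (k : IsTest ζ) :
    ∇ (η + ζ) = ∇ η + ∇ ζ := by
  ext1 x
  simp [gradient, fderiv_add (h.differentiable x) (k.differentiable x)]

theorem IsTest.gradient_smul {η : R3 → ℝ} (c : ℝ) (h : IsTest η) :
    ∇ (c • η) = c • ∇ η := by
  ext1 x
  simp [gradient, fderiv_const_smul (h.differentiable x)]

theorem IsTest.continuous {η : R3 → ℝ} (h : IsTest η) : Continuous η := h.1.continuous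

theorem IsTest.continuous_gradient {η : R3 → ℝ} (h : IsTest η) : Continuous (∇ η) :=
  (InnerProductSpace.toDual ℝ R3).symm.continuous.comp (h.1.continuous_fderiv (by simp))

theorem IsTest.hasCompactSupport_gradient {η : R3 → ℝ} (h : IsTest η) :
    HasCompactSupport (∇ η) :=
  (h.2.fderiv (𝕜 := ℝ)).comp_left (g := (InnerProductSpace.toDual ℝ R3).symm) (by simp)

theorem IsTest.memLp {η : R3 → ℝ} (h : IsTest η) (p : ℝ≥0∞) : MemLp η p :=
  h.continuous.memLp_of_hasCompactSupport h.2

theorem IsTest.memLp_gradient {η : R3 → ℝ} (h : IsTest η) (p : ℝ≥0∞) : MemLp (∇ η) p :=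
  h.continuous_gradient.memLp_of_hasCompactSupport h.hasCompactSupport_gradient

theorem norm_gradient (f : R3 → ℝ) (x : R3) : ‖∇ f x‖ = ‖fderiv ℝ f x‖ := by
  simp [gradient]

/-- The Sobolev inequality for test functions. -/
theorem exists_sobolev_const : ∃ C : ℝ≥0, ∀ η : R3 → ℝ, IsTest η →
    eLpNorm η 6 ≤ C * eLpNorm (∇ η) 2 := by
  refine ⟨SNormLESNormFDerivOfEqConst ℝ (volume : Measure R3) (2 : ℝ≥0), fun η hη => ?_⟩
  have h := eLpNorm_le_eLpNorm_fderiv_of_eq (volume : Measure R3) (u := η)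
    (hη.1.of_le (by simp)) hη.2 (p := 2) (p' := 6) (by norm_num) (by simp)
    (by simp; norm_num)
  have e : eLpNorm (∇ η) 2 = eLpNorm (fderiv ℝ η) 2 (volume : Measure R3) :=
    eLpNorm_congr_norm_ae (ae_of_all _ (norm_gradient η))
  rw [e]
  exact_mod_cast h

/-! ### Mollification -/

/-- Convolution with a normalized bump function does not increase the `L²` norm. -/
theorem eLpNorm_convolution_normed_le {F : Type*} [NormedAddCommGroup F] [NormedSpace ℝ F]
    (φ : ContDiffBump (0 : R3)) {g : R3 → F} (hg : StronglyMeasurable g) :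
    eLpNorm (φ.normed volume ⋆[lsmul ℝ ℝ, volume] g) 2 ≤ eLpNorm g 2 := by
  set ρ : R3 → ℝ := φ.normed volume
  have ρcont : Continuous ρ := φ.continuous_normed
  have ρint : ∫⁻ t, ‖ρ t‖ₑ = 1 := by
    rw [← ofReal_integral_norm_eq_lintegral_enorm φ.integrable_normed]
    simp only [Real.norm_of_nonneg (φ.nonneg_normed _)]
    simp [φ.integral_normed]
  have ρm : Measurable fun t => ‖ρ t‖ₑ := ρcont.measurable.enorm
  -- With respect to the probability measure `|ρ| dt`, Jensen's inequality bounds `|ρ * g|²(x)` by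
  -- the mean of `|g(x - t)|²`; Tonelli and translation invariance then conclude.
  set ν : Measure R3 := volume.withDensity fun t => ‖ρ t‖ₑ
  have νprob : IsProbabilityMeasure ν := ⟨by simp [ν, ρint]⟩
  have hpt : ∀ x, ‖(ρ ⋆[lsmul ℝ ℝ, volume] g) x‖ₑ ^ 2 ≤ ∫⁻ t, ‖ρ t‖ₑ * ‖g (x - t)‖ₑ ^ 2 := by
    intro x
    have gm : StronglyMeasurable fun t => g (x - t) :=
      hg.comp_measurable (measurable_const.sub measurable_id)
    have h1 : ‖(ρ ⋆[lsmul ℝ ℝ, volume] g) x‖ₑ ≤ eLpNorm (fun t => g (x - t)) 1 ν := by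
      rw [eLpNorm_one_eq_lintegral_enorm, lintegral_withDensity_eq_lintegral_mul _ ρm gm.enorm]
      refine (enorm_integral_le_lintegral_enorm _).trans (le_of_eq ?_)
      simp [enorm_smul]
    have h2 := h1.trans (eLpNorm_le_eLpNorm_of_exponent_le (p := 1) (q := 2) (by norm_num)
      gm.aestronglyMeasurable)
    calc _ ≤ (eLpNorm (fun t => g (x - t)) 2 ν) ^ 2 := by gcongr
      _ = ∫⁻ t, ‖g (x - t)‖ₑ ^ 2 ∂ν := by
        have := eLpNorm_nnreal_pow_eq_lintegral (μ := ν) (f := fun t => g (x - t)) (p := 2)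
          (by norm_num)
        simpa using this
      _ = _ := by
        rw [lintegral_withDensity_eq_lintegral_mul _ ρm (gm.enorm.pow_const 2)]
        rfl
  have key : (eLpNorm (ρ ⋆[lsmul ℝ ℝ, volume] g) 2) ^ 2 ≤ (eLpNorm g 2) ^ 2 := by
    have e1 := eLpNorm_nnreal_pow_eq_lintegral (μ := (volume : Measure R3)) (p := 2)
      (f := ρ ⋆[lsmul ℝ ℝ, volume] g) (by norm_num)
    have e2 := eLpNorm_nnreal_pow_eq_lintegral (μ := (volume : Measure R3)) (p := 2)
      (f := g) (by norm_num)
    simp only [NNReal.coe_ofNat, ENNReal.rpow_ofNat, ENNReal.coe_ofNat] at e1 e2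
    rw [e1, e2]
    calc _ ≤ ∫⁻ x, ∫⁻ t, ‖ρ t‖ₑ * ‖g (x - t)‖ₑ ^ 2 := lintegral_mono hpt
      _ = ∫⁻ t, ∫⁻ x, ‖ρ t‖ₑ * ‖g (x - t)‖ₑ ^ 2 := by
        refine lintegral_lintegral_swap (Measurable.aemeasurable ?_)
        refine (ρm.comp measurable_snd).mul (Measurable.pow_const ?_ 2)
        exact hg.enorm.comp (measurable_fst.sub measurable_snd)
      _ = ∫⁻ t, ‖ρ t‖ₑ * ∫⁻ x, ‖g x‖ₑ ^ 2 := by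
        refine lintegral_congr fun t => ?_
        rw [lintegral_const_mul' _ _ enorm_ne_top]
        congr 1
        exact lintegral_sub_right_eq_self (fun x => ‖g x‖ₑ ^ 2) t
      _ = _ := by rw [lintegral_mul_const _ ρm, ρint, one_mul]
  exact (ENNReal.pow_le_pow_left_iff (by norm_num)).1 key

theorem IsTest.comp_const_sub {η : R3 → ℝ} (h : IsTest η) (x : R3) :
    IsTest fun y => η (x - y) :=
  ⟨h.1.comp (contDiff_const.sub contDiff_id), h.2.comp_homeomorph (Homeomorph.subLeft x)⟩

/-- The gradient of a mollified function is the mollification of the weak gradient. -/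
theorem IsWeakGradient.gradient_convolution {f : R3 → ℝ} {G : R3 → R3}
    (h : IsWeakGradient f G) {ρ : R3 → ℝ} (hρ : IsTest ρ) (x : R3) :
    ∇ (ρ ⋆[lsmul ℝ ℝ, volume] f) x = (ρ ⋆[lsmul ℝ ℝ, volume] G) x := by
  have hη := hρ.comp_const_sub x
  have hd := hρ.2.hasFDerivAt_convolution_right (μ := volume) (lsmul ℝ ℝ).flip h.1
    (hρ.1.of_le (by simp)) x
  rw [convolution_flip] at hd
  -- The derivative in `x` of the kernel `ρ(x - y)` is minus its derivative in `y`, so the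
  -- definition of weak gradient applies to the test function `y ↦ ρ(x - y)`.
  have hgr : ∀ y v, ⟪∇ (fun y => ρ (x - y)) y, v⟫ = - fderiv ℝ ρ (x - y) v := by
    intro y v
    have e : HasFDerivAt (fun y => ρ (x - y)) (-(fderiv ℝ ρ (x - y))) y := by
      simpa [Function.comp_def] using (hρ.differentiable (x - y)).hasFDerivAt.comp y ((hasFDerivAt_id y).const_sub x)
    rw [inner_gradient_left, e.fderiv, neg_apply]
  have i1 : Integrable fun y => f y • ∇ (fun y => ρ (x - y)) y :=
    h.1.integrable_smul_right_of_hasCompactSupport hη.continuous_gradient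
      hη.hasCompactSupport_gradient
  have i2 : Integrable fun y => ρ (x - y) • G y :=
    h.2.1.integrable_smul_left_of_hasCompactSupport hη.continuous hη.2
  refine ext_inner_right ℝ fun v => ?_
  rw [inner_gradient_left, hd.fderiv, convolution_precompR_apply _ h.1
    (hρ.2.fderiv ℝ) (hρ.1.continuous_fderiv (by simp)), convolution_def, convolution_eq_swap]
  simp only [ContinuousLinearMap.lsmul_apply, ContinuousLinearMap.flip_apply]
  rw [← neg_neg (∫ y, ρ (x - y) • G y), ← h.2.2 _ hη, inner_neg_left, real_inner_comm,
    ← integral_inner i1, ← integral_neg]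
  refine integral_congr_ae (ae_of_all _ fun y => ?_)
  beta_reduce
  rw [real_inner_comm, real_inner_smul_left, hgr, smul_eq_mul]
  ring

/-- Sobolev embedding `H¹(ℝ³) ⊂ L⁶(ℝ³)`. -/
theorem memLp_six_of_isWeakGradient {u : L2} {G : L2Vec} (h : IsWeakGradient u G) :
    MemLp u 6 := by
  obtain ⟨C, hC⟩ := exists_sobolev_const
  -- Truncating and mollifying `u` gives test functions `w n = χ(x/(n+1)) (ρ n * u)` that converge
  -- to `u` a.e. and have gradients bounded in `L²`. Sobolev bounds them in `L⁶`, and Fatou passes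
  -- the bound to `u`.
  let χ : ContDiffBump (0 : R3) := ⟨1, 2, by norm_num, by norm_num⟩
  have hχ : IsTest χ := ⟨χ.contDiff, χ.hasCompactSupport⟩
  obtain ⟨M, hM⟩ := hχ.hasCompactSupport_gradient.exists_bound_of_continuous hχ.continuous_gradient
  have hM0 : 0 ≤ M := (norm_nonneg _).trans (hM 0)
  let φ : ℕ → ContDiffBump (0 : R3) := fun n =>
    ⟨(1 / ((n : ℝ) + 1)) / 2, 1 / ((n : ℝ) + 1), by positivity, half_lt_self (by positivity)⟩
  let a : ℕ → ℝ := fun n => 1 / ((n : ℝ) + 1)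
  have a0 : ∀ n, 0 < a n := fun n => by positivity
  have a1 : ∀ n, a n ≤ 1 := fun n => by
    simp only [a]; rw [div_le_one (by positivity)]; linarith [n.cast_nonneg (α := ℝ)]
  have alim : Tendsto a atTop (𝓝 0) := tendsto_one_div_add_atTop_nhds_zero_nat
  let ρ : ℕ → R3 → ℝ := fun n => (φ n).normed volume
  have hρ : ∀ n, IsTest (ρ n) := fun n => ⟨(φ n).contDiff_normed, (φ n).hasCompactSupport_normed⟩
  let v : ℕ → R3 → ℝ := fun n => ρ n ⋆[lsmul ℝ ℝ, volume] u
  have hv : ∀ n, ContDiff ℝ ∞ (v n) := fun n =>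
    (hρ n).2.contDiff_convolution_left _ (hρ n).1 h.1
  let χn : ℕ → R3 → ℝ := fun n x => χ (a n • x)
  have hχn : ∀ n, IsTest (χn n) := fun n =>
    ⟨hχ.1.comp (contDiff_const_smul (a n)),
      hχ.2.comp_homeomorph (Homeomorph.smulOfNeZero (a n) (a0 n).ne')⟩
  have hχgr : ∀ n x, ‖∇ (χn n) x‖ ≤ M := by
    intro n x
    have : fderiv ℝ (χn n) x = a n • fderiv ℝ χ (a n • x) := fderiv_comp_smul _
    rw [norm_gradient, this, norm_smul, ← norm_gradient, Real.norm_of_nonneg (a0 n).le]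
    exact (mul_le_mul (a1 n) (hM _) (norm_nonneg _) zero_le_one).trans (one_mul M).le
  let w : ℕ → R3 → ℝ := fun n x => χn n x * v n x
  have hw : ∀ n, IsTest (w n) := fun n => ⟨(hχn n).1.mul (hv n), (hχn n).2.mul_right⟩
  have hgw : ∀ n x, ‖∇ (w n) x‖ ≤ ‖‖(ρ n ⋆[lsmul ℝ ℝ, volume] G) x‖ + ‖M * v n x‖‖ := by
    intro n x
    have hvd : DifferentiableAt ℝ (v n) x := (hv n).differentiable (by simp) x
    have e : fderiv ℝ (w n) x = χn n x • fderiv ℝ (v n) x + v n x • fderiv ℝ (χn n) x :=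
      fderiv_fun_mul ((hχn n).differentiable x) hvd
    rw [norm_gradient, e, ← h.gradient_convolution (hρ n) x, Real.norm_of_nonneg (by positivity)]
    refine (norm_add_le _ _).trans ?_
    rw [norm_smul, norm_smul, ← norm_gradient, ← norm_gradient, norm_mul, mul_comm ‖v n x‖,
      Real.norm_of_nonneg hM0]
    refine add_le_add ?_ (mul_le_mul_of_nonneg_right (hχgr n x) (norm_nonneg _))
    refine mul_le_of_le_one_left (norm_nonneg _) ?_
    rw [Real.norm_of_nonneg χ.nonneg]
    exact χ.le_one
  have hbound : ∀ n, eLpNorm (w n) 6 ≤ C * (eLpNorm G 2 + ‖M‖ₑ * eLpNorm u 2) := by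
    intro n
    refine (hC _ (hw n)).trans ?_
    gcongr
    refine (eLpNorm_mono (hgw n)).trans ?_
    have hGc : Continuous (ρ n ⋆[lsmul ℝ ℝ, volume] (G : R3 → R3)) :=
      (hρ n).2.continuous_convolution_left _ (hρ n).continuous h.2.1
    refine (eLpNorm_add_le hGc.norm.aestronglyMeasurable
      (continuous_const.mul (hv n).continuous).norm.aestronglyMeasurable (by norm_num)).trans ?_
    rw [eLpNorm_norm, eLpNorm_norm]
    refine add_le_add (eLpNorm_convolution_normed_le _ (Lp.stronglyMeasurable G)) ?_
    change eLpNorm (M • v n) 2 _ ≤ _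
    rw [eLpNorm_const_smul]
    gcongr
    exact eLpNorm_convolution_normed_le _ (Lp.stronglyMeasurable u)
  have hlim : ∀ᵐ x, Tendsto (fun n => w n x) atTop (𝓝 (u x)) := by
    -- Lebesgue differentiation needs comparable inner and outer radii; here the outer one is
    -- exactly twice the inner, whence `K = 2`.
    filter_upwards [ContDiffBump.ae_convolution_tendsto_right_of_locallyIntegrable (φ := φ)
      (l := atTop) (K := 2) alim (Eventually.of_forall fun n => by simp [φ]; linarith) h.1]
      with x hx
    have h1 : Tendsto (fun n => χn n x) atTop (𝓝 1) := by
      have : Tendsto (fun n => χ (a n • x)) atTop (𝓝 (χ ((0 : ℝ) • x))) :=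
        (hχ.continuous.tendsto _).comp (alim.smul_const x)
      simpa only [zero_smul, χ.one_of_mem_closedBall (Metric.mem_closedBall_self zero_le_one)]
        using this
    simpa using h1.mul hx
  refine ⟨(Lp.aestronglyMeasurable u), ?_⟩
  refine (Lp.eLpNorm_lim_le_liminf_eLpNorm
    (fun n => (hw n).continuous.aestronglyMeasurable) _ hlim).trans_lt ?_
  refine (liminf_le_of_frequently_le' (Frequently.of_forall hbound)).trans_lt ?_
  exact ENNReal.mul_lt_top (by simp) (ENNReal.add_lt_top.2
    ⟨(Lp.memLp G).2, ENNReal.mul_lt_top (by simp) (Lp.memLp u).2⟩)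

/-! ### The nonlinear term -/

section Nonlin

variable {W : ℝ → ℝ} {m : ℝ}

theorem IsAdmissible.hasDerivAt_nonlin (hW : IsAdmissible W m) (s : ℝ) :
    HasDerivAt (nonlin W m) (deriv W s - m ^ 2 * s) s := by
  have h1 : HasDerivAt W (deriv W s) s :=
    (hW.contDiff.differentiable (by norm_num) s).hasDerivAt
  have h2 : HasDerivAt (fun s : ℝ => 1 / 2 * m ^ 2 * s ^ 2) (m ^ 2 * s) s := by
    refine ((hasDerivAt_pow 2 s).const_mul (1 / 2 * m ^ 2)).congr_deriv ?_
    simp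
    ring
  exact h1.sub h2

theorem IsAdmissible.deriv_nonlin (hW : IsAdmissible W m) :
    deriv (nonlin W m) = fun s => deriv W s - m ^ 2 * s :=
  funext fun s => (hW.hasDerivAt_nonlin s).deriv

theorem IsAdmissible.continuous_deriv (hW : IsAdmissible W m) : Continuous (deriv W) :=
  hW.contDiff.continuous_deriv (by norm_num)

/-- With `e = r - 1` or `p - 1`, this reduces the growth hypothesis to the two endpoint powers,
which the `L²` and `L⁶` norms control. -/
theorem rpow_le_add_pow_five {x e : ℝ} (hx : 0 ≤ x) (h1 : 1 ≤ e) (h5 : e ≤ 5) :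
    x ^ e ≤ x + x ^ 5 := by
  have h5' : x ^ (5 : ℝ) = x ^ 5 := by exact_mod_cast Real.rpow_natCast x 5
  rcases le_total x 1 with h | h
  · have : x ^ e ≤ x ^ (1 : ℝ) := Real.rpow_le_rpow_of_exponent_ge' hx h zero_le_one h1
    rw [Real.rpow_one] at this
    linarith [pow_nonneg hx 5]
  · have : x ^ e ≤ x ^ (5 : ℝ) := Real.rpow_le_rpow_of_exponent_le h h5
    rw [h5'] at this
    linarith

theorem IsAdmissible.exists_deriv_bound (hW : IsAdmissible W m) :
    ∃ C : ℝ, 0 ≤ C ∧ ∀ s, |deriv W s - m ^ 2 * s| ≤ C * (|s| + |s| ^ 5) := by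
  obtain ⟨c₁, c₂, r, p, hr, hp, h⟩ := hW.growth
  refine ⟨|c₁| + |c₂|, by positivity, fun s => ?_⟩
  have hs := h s
  rw [hW.deriv_nonlin] at hs
  have key : ∀ c e : ℝ, e ∈ Set.Ioo (2 : ℝ) 6 →
      c * |s| ^ (e - 1) ≤ |c| * (|s| + |s| ^ 5) := fun c e he =>
    mul_le_mul (le_abs_self c)
      (rpow_le_add_pow_five (abs_nonneg s) (by linarith [he.1]) (by linarith [he.2]))
      (by positivity) (abs_nonneg c)
  linarith [key c₁ r hr, key c₂ p hp]

/-- The mean value inequality on the segment from `0` to `s`, where `N(0) = 0`, bounds `N` with the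
constant already obtained for `N'`. -/
theorem IsAdmissible.exists_bound (hW : IsAdmissible W m) :
    ∃ C : ℝ, 0 ≤ C ∧ ∀ s, |nonlin W m s| ≤ C * (|s| ^ 2 + |s| ^ 6) ∧
      |deriv W s - m ^ 2 * s| ≤ C * (|s| + |s| ^ 5) := by
  obtain ⟨C, hC, h⟩ := hW.exists_deriv_bound
  refine ⟨C, hC, fun s => ⟨?_, h s⟩⟩
  have h0 : nonlin W m 0 = 0 := by simp [nonlin, hW.zero]
  have := (convex_uIcc (0 : ℝ) s).norm_image_sub_le_of_norm_hasDerivWithin_le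
    (f := nonlin W m) (C := C * (|s| + |s| ^ 5))
    (fun t _ => (hW.hasDerivAt_nonlin t).hasDerivWithinAt) (fun t ht => ?_)
    (Set.left_mem_uIcc) (Set.right_mem_uIcc)
  · rw [h0, sub_zero, sub_zero, Real.norm_eq_abs, Real.norm_eq_abs] at this
    linarith
  · have hts : |t| ≤ |s| := by
      simpa using Set.abs_sub_left_of_mem_uIcc ht
    exact (h t).trans (by gcongr)

theorem IsAdmissible.integrable_nonlin (hW : IsAdmissible W m) {u : R3 → ℝ}
    (h2 : MemLp u 2) (h6 : MemLp u 6) : Integrable fun x => nonlin W m (u x) := by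
  obtain ⟨C, hC, h⟩ := hW.exists_bound
  have i2 : Integrable fun x => ‖u x‖ ^ 2 := h2.integrable_norm_pow (p := 2) (by norm_num)
  have i6 : Integrable fun x => ‖u x‖ ^ 6 := h6.integrable_norm_pow (p := 6) (by norm_num)
  have hc : Continuous (nonlin W m) :=
    continuous_iff_continuousAt.2 fun s => (hW.hasDerivAt_nonlin s).continuousAt
  exact ((i2.add i6).const_mul C).mono' (hc.comp_aestronglyMeasurable h2.1)
    (ae_of_all _ fun x => (h (u x)).1)

/-- The linear and quintic powers of `|u|` are dominated by `2 + |u|² + |u|⁶`; the constant term is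
why integrability is only local. -/
theorem IsAdmissible.locallyIntegrable_deriv (hW : IsAdmissible W m) {u : R3 → ℝ}
    (h2 : MemLp u 2) (h6 : MemLp u 6) : LocallyIntegrable fun x => deriv W (u x) := by
  obtain ⟨C, hC, h⟩ := hW.exists_deriv_bound
  have i2 : Integrable fun x => ‖u x‖ ^ 2 := h2.integrable_norm_pow (p := 2) (by norm_num)
  have i6 : Integrable fun x => ‖u x‖ ^ 6 := h6.integrable_norm_pow (p := 6) (by norm_num)
  have hb : LocallyIntegrable fun x =>
      (C + m ^ 2) * (2 + ‖u x‖ ^ 2 + ‖u x‖ ^ 6) := by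
    simp_rw [mul_add]
    exact ((locallyIntegrable_const _).add (i2.const_mul _).locallyIntegrable).add
      (i6.const_mul _).locallyIntegrable
  refine hb.mono (hW.continuous_deriv.comp_aestronglyMeasurable h2.1) (ae_of_all _ fun x => ?_)
  rw [Real.norm_eq_abs, Real.norm_of_nonneg (by positivity), Real.norm_eq_abs]
  have hx := h (u x)
  set a := |u x| with ha
  have a0 : 0 ≤ a := abs_nonneg _
  have h1 : |deriv W (u x)| ≤ C * (a + a ^ 5) + m ^ 2 * a := by
    have e : |m ^ 2 * u x| = m ^ 2 * a := by rw [abs_mul, abs_of_nonneg (sq_nonneg m)]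
    have := abs_sub_abs_le_abs_sub (deriv W (u x)) (m ^ 2 * u x)
    linarith
  have p1 : a + a ^ 5 ≤ 2 + a ^ 2 + a ^ 6 := by
    rcases le_total a 1 with h | h
    · nlinarith [pow_le_one₀ a0 h (n := 5), pow_nonneg a0 6, pow_nonneg a0 2]
    · nlinarith [pow_le_pow_right₀ h (show 5 ≤ 6 by norm_num),
        pow_le_pow_right₀ h (show 1 ≤ 2 by norm_num)]
  calc _ ≤ C * (a + a ^ 5) + m ^ 2 * a := h1
    _ ≤ C * (2 + a ^ 2 + a ^ 6) + m ^ 2 * (2 + a ^ 2 + a ^ 6) := by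
      gcongr
      linarith [pow_nonneg a0 5]
    _ = _ := by ring

/-- The derivative of the potential energy along `u + t ξ`. -/
theorem IsAdmissible.hasDerivAt_integral_nonlin (hW : IsAdmissible W m) {u ξ : R3 → ℝ}
    (h2 : MemLp u 2) (h6 : MemLp u 6) (k2 : MemLp ξ 2) (k6 : MemLp ξ 6) :
    HasDerivAt (fun t : ℝ => ∫ x, nonlin W m (u x + t * ξ x))
      (∫ x, (deriv W (u x) - m ^ 2 * u x) * ξ x) 0 := by
  obtain ⟨C, hC, h⟩ := hW.exists_deriv_bound
  have hc : Continuous (nonlin W m) :=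
    continuous_iff_continuousAt.2 fun s => (hW.hasDerivAt_nonlin s).continuousAt
  have hc' : Continuous fun s => deriv W s - m ^ 2 * s :=
    hW.continuous_deriv.sub (continuous_const.mul continuous_id)
  have a2 : MemLp (fun x => ‖u x‖ + ‖ξ x‖) 2 := h2.norm.add k2.norm
  have a6 : MemLp (fun x => ‖u x‖ + ‖ξ x‖) 6 := h6.norm.add k6.norm
  have i2 := a2.integrable_norm_pow (p := 2) (by norm_num)
  have i6 := a6.integrable_norm_pow (p := 6) (by norm_num)
  have hm : ∀ t : ℝ, AEStronglyMeasurable (fun x => u x + t * ξ x) := fun t =>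
    h2.1.add (k2.1.const_mul t)
  have main := (hasDerivAt_integral_of_dominated_loc_of_deriv_le (μ := (volume : Measure R3))
    (F := fun (t : ℝ) x => nonlin W m (u x + t * ξ x))
    (F' := fun (t : ℝ) x => (deriv W (u x + t * ξ x) - m ^ 2 * (u x + t * ξ x)) * ξ x)
    (x₀ := (0 : ℝ)) (s := Metric.ball 0 1)
    -- For `|t| < 1`, both `|u + tξ|` and `|ξ|` are at most `b = |u| + |ξ|`, so the derivative is at
    -- most `C(b + b⁵)b`.
    (bound := fun x => C * (‖‖u x‖ + ‖ξ x‖‖ ^ 2 + ‖‖u x‖ + ‖ξ x‖‖ ^ 6))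
    (Metric.ball_mem_nhds _ zero_lt_one)
    (Eventually.of_forall fun t => hc.comp_aestronglyMeasurable (hm t))
    (by simpa using hW.integrable_nonlin h2 h6)
    ((hc'.comp_aestronglyMeasurable (hm 0)).mul k2.1)
    (ae_of_all _ fun x t ht => ?_)
    ((i2.add i6).const_mul C)
    (ae_of_all _ fun x t _ => ?_)).2
  · simpa using main
  · have ht1 : |t| ≤ 1 := by
      rw [mem_ball_zero_iff] at ht
      exact ht.le
    rw [Real.norm_of_nonneg (add_nonneg (norm_nonneg (u x)) (norm_nonneg (ξ x)))]
    set b := ‖u x‖ + ‖ξ x‖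
    have hb : |u x + t * ξ x| ≤ b := by
      refine (abs_add_le _ _).trans ?_
      rw [abs_mul]
      exact add_le_add le_rfl (mul_le_of_le_one_left (abs_nonneg _) ht1)
    have hb' : |ξ x| ≤ b := le_add_of_nonneg_left (norm_nonneg _)
    have hb0 : 0 ≤ b := (abs_nonneg _).trans hb'
    rw [norm_mul, Real.norm_eq_abs, Real.norm_eq_abs]
    calc _ ≤ C * (b + b ^ 5) * b := by
          refine mul_le_mul ((h _).trans ?_) hb' (abs_nonneg _) (by positivity)
          gcongr
      _ = _ := by ring
  · have e : HasDerivAt (fun t : ℝ => u x + t * ξ x) (ξ x) t := by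
      simpa using ((hasDerivAt_id t).mul_const (ξ x)).const_add (u x)
    exact (hW.hasDerivAt_nonlin _).comp t e

end Nonlin

/-! ### Hölder pairings -/

instance holderTriple_six : ENNReal.HolderTriple 6 (6 / 5) 1 := by
  refine ⟨?_⟩
  rw [← ENNReal.toReal_eq_toReal_iff' (by simp) (by simp), ENNReal.toReal_add (by simp) (by simp)]
  simp
  norm_num

instance holderTriple_two_three : ENNReal.HolderTriple 2 3 (6 / 5) := by
  refine ⟨?_⟩
  rw [← ENNReal.toReal_eq_toReal_iff' (by simp) (by simp), ENNReal.toReal_add (by simp) (by simp)]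
  simp
  norm_num

instance holderTriple_six_two : ENNReal.HolderTriple 6 2 (3 / 2) := by
  refine ⟨?_⟩
  rw [← ENNReal.toReal_eq_toReal_iff' (by simp) (by simp), ENNReal.toReal_add (by simp) (by simp)]
  simp
  norm_num

/-- Hölder's inequality for the pairing `∫ η • g`. -/
theorem enorm_integral_smul_le {p q : ℝ≥0∞} [ENNReal.HolderTriple p q 1] {F : Type*}
    [NormedAddCommGroup F] [NormedSpace ℝ F] {η : R3 → ℝ} {g : R3 → F}
    (hη : AEStronglyMeasurable η) (hg : AEStronglyMeasurable g) :
    ‖∫ x, η x • g x‖ₑ ≤ eLpNorm η p * eLpNorm g q := by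
  refine (enorm_integral_le_lintegral_enorm _).trans ?_
  refine le_trans (le_of_eq ?_) (eLpNorm_smul_le_mul_eLpNorm (r := 1) hg hη)
  rw [eLpNorm_one_eq_lintegral_enorm]
  rfl

/-- Hölder pairings are continuous in their first argument. -/
theorem tendsto_integral_smul_left {p q : ℝ≥0∞} [ENNReal.HolderTriple p q 1] {F : Type*}
    [NormedAddCommGroup F] [NormedSpace ℝ F] {η : ℕ → R3 → ℝ} {φ : R3 → ℝ} {g : R3 → F}
    (hη : ∀ n, MemLp (η n) p) (hφ : MemLp φ p) (hg : MemLp g q)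
    (h : Tendsto (fun n => eLpNorm (η n - φ) p) atTop (𝓝 0)) :
    Tendsto (fun n => ∫ x, η n x • g x) atTop (𝓝 (∫ x, φ x • g x)) := by
  refine tendsto_integral_of_L1' _ (hg.smul (r := 1) hφ).1
    (Eventually.of_forall fun n => memLp_one_iff_integrable.1 (hg.smul (hη n))) ?_
  refine tendsto_of_tendsto_of_tendsto_of_le_of_le tendsto_const_nhds
    (h := fun n => eLpNorm (η n - φ) p * eLpNorm g q) ?_ (fun _ => zero_le) fun n => ?_
  · simpa using ENNReal.Tendsto.mul_const h (Or.inr hg.2.ne)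
  · refine (le_of_eq ?_).trans (eLpNorm_smul_le_mul_eLpNorm (r := 1) hg.1 ((hη n).1.sub hφ.1))
    congr 1
    ext x
    simp [sub_smul]

/-- Hölder pairings are continuous in their second argument. -/
theorem tendsto_integral_smul_right {p q : ℝ≥0∞} [ENNReal.HolderTriple p q 1] {F : Type*}
    [NormedAddCommGroup F] [NormedSpace ℝ F] {η : R3 → ℝ} {g : ℕ → R3 → F} {G : R3 → F}
    (hη : MemLp η p) (hg : ∀ n, MemLp (g n) q) (hG : MemLp G q)
    (h : Tendsto (fun n => eLpNorm (g n - G) q) atTop (𝓝 0)) :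
    Tendsto (fun n => ∫ x, η x • g n x) atTop (𝓝 (∫ x, η x • G x)) := by
  refine tendsto_integral_of_L1' _ (hG.smul (r := 1) hη).1
    (Eventually.of_forall fun n => memLp_one_iff_integrable.1 ((hg n).smul hη)) ?_
  refine tendsto_of_tendsto_of_tendsto_of_le_of_le tendsto_const_nhds
    (h := fun n => eLpNorm η p * eLpNorm (g n - G) q) ?_ (fun _ => zero_le) fun n => ?_
  · simpa using ENNReal.Tendsto.const_mul h (Or.inr hη.2.ne)
  · refine (le_of_eq ?_).trans (eLpNorm_smul_le_mul_eLpNorm (r := 1) ((hg n).1.sub hG.1) hη.1)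
    congr 1
    ext x
    simp [smul_sub]

/-! ### Gradients of test functions as a subspace of `L²` -/

/-- The space of test functions. -/
def testSpace : Submodule ℝ (R3 → ℝ) where
  carrier := {η | IsTest η}
  add_mem' := IsTest.add
  zero_mem' := IsTest.zero
  smul_mem' := fun c _ h => h.smul c

/-- The gradient of a test function, as an element of `L²`. -/
def gradL2 : testSpace →ₗ[ℝ] L2Vec where
  toFun η := (η.2.memLp_gradient 2).toLp (∇ (η : R3 → ℝ))
  map_add' η ζ := by
    rw [← MemLp.toLp_add]
    exact MemLp.toLp_congr _ _ (by rw [Submodule.coe_add, IsTest.gradient_add η.2 ζ.2])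
  map_smul' c η := by
    rw [RingHom.id_apply, ← MemLp.toLp_const_smul]
    exact MemLp.toLp_congr _ _ (by rw [Submodule.coe_smul, IsTest.gradient_smul c η.2])

theorem coeFn_gradL2 (η : testSpace) : gradL2 η =ᵐ[volume] ∇ (η : R3 → ℝ) :=
  (η.2.memLp_gradient 2).coeFn_toLp

theorem enorm_gradL2 (η : testSpace) : ‖gradL2 η‖ₑ = eLpNorm (∇ (η : R3 → ℝ)) 2 :=
  Lp.enorm_toLp (η.2.memLp_gradient 2)

/-- Makes the weak divergence a statement about inner products in `L²`, so that orthogonality and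
limits can be used. -/
theorem inner_gradL2 (F : L2Vec) (η : testSpace) :
    ⟪F, gradL2 η⟫ = ∫ x, ⟪F x, ∇ (η : R3 → ℝ) x⟫ := by
  rw [L2.inner_def]
  refine integral_congr_ae ?_
  filter_upwards [coeFn_gradL2 η] with x hx
  rw [hx]

/-! ### Solving the divergence equation, and potentials of gradient fields -/

theorem locallyIntegrable_coe {F : Type*} [NormedAddCommGroup F]
    (f : Lp F 2 (volume : Measure R3)) : LocallyIntegrable f (volume : Measure R3) :=
  (Lp.memLp f).locallyIntegrable (by norm_num)

theorem one_le_six_fifths : (1 : ℝ≥0∞) ≤ 6 / 5 := by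
  rw [ENNReal.le_div_iff_mul_le (by simp) (by simp)]
  norm_num

/-- Riesz representation of a functional dominated by a linear map into a Hilbert space. -/
theorem exists_inner_eq_of_norm_le {V H : Type*} [AddCommGroup V] [Module ℝ V]
    [NormedAddCommGroup H] [InnerProductSpace ℝ H] [CompleteSpace H] (A : V →ₗ[ℝ] H)
    (L : V →ₗ[ℝ] ℝ) (K : ℝ) (hL : ∀ v, ‖L v‖ ≤ K * ‖A v‖) : ∃ F : H, ∀ v, ⟪F, A v⟫ = L v := by
  -- The bound forces `L` to vanish on the kernel of `A`, so `L` descends to a bounded functional on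
  -- the range; Hahn-Banach extends it to `H`.
  have hker : LinearMap.ker A ≤ LinearMap.ker L := by
    intro v hv
    rw [LinearMap.mem_ker] at hv ⊢
    simpa [hv] using hL v
  let ℓ : LinearMap.range A →ₗ[ℝ] ℝ :=
    ((LinearMap.ker A).liftQ L hker).comp A.quotKerEquivRange.symm.toLinearMap
  have hℓ : ∀ v, ℓ ⟨A v, LinearMap.mem_range_self A v⟩ = L v := by
    intro v
    change (LinearMap.ker A).liftQ L hker (A.quotKerEquivRange.symm ⟨A v, _⟩) = _
    rw [LinearMap.quotKerEquivRange_symm_apply_image A v, Submodule.mkQ_apply,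
      Submodule.liftQ_apply]
  have hℓb : ∀ w, ‖ℓ w‖ ≤ K * ‖w‖ := by
    rintro ⟨_, v, rfl⟩
    rw [hℓ]
    exact hL v
  obtain ⟨g, hg, -⟩ := exists_extension_norm_eq (𝕜 := ℝ) _ (ℓ.mkContinuous K hℓb)
  refine ⟨(InnerProductSpace.toDual ℝ H).symm g, fun v => ?_⟩
  rw [InnerProductSpace.toDual_symm_apply, hg ⟨A v, LinearMap.mem_range_self A v⟩, LinearMap.mkContinuous_apply, hℓ]

/-- Every element of `L^{6/5}` is the divergence of an element of `L²`. -/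
theorem exists_isWeakDivergence {f : R3 → ℝ} (hf : MemLp f (6 / 5)) :
    ∃ F : L2Vec, IsWeakDivergence F f := by
  obtain ⟨C, hC⟩ := exists_sobolev_const
  have hint : ∀ η : testSpace, Integrable fun x => (η : R3 → ℝ) x * f x := fun η =>
    memLp_one_iff_integrable.1 (hf.mul' (η.2.memLp 6))
  let L : testSpace →ₗ[ℝ] ℝ :=
    { toFun := fun η => -∫ x, (η : R3 → ℝ) x * f x
      map_add' := fun η ζ => by
        simp only [Submodule.coe_add, Pi.add_apply, add_mul]
        rw [integral_add (hint η) (hint ζ), neg_add]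
      map_smul' := fun c η => by
        simp only [Submodule.coe_smul, Pi.smul_apply, smul_eq_mul, mul_assoc, RingHom.id_apply]
        rw [integral_const_mul, mul_neg] }
  obtain ⟨A, hA⟩ : ∃ A : ℝ≥0, ∀ η : testSpace,
      ‖∫ x, (η : R3 → ℝ) x * f x‖ₑ ≤ eLpNorm (η : R3 → ℝ) 6 * A := by
    refine ⟨(eLpNorm f (6 / 5)).toNNReal, fun η => ?_⟩
    rw [ENNReal.coe_toNNReal hf.2.ne]
    exact enorm_integral_smul_le η.2.continuous.aestronglyMeasurable hf.1
  -- Hölder with exponents `6` and `6/5`, followed by Sobolev, dominates the functional by `‖∇η‖`.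
  have hL : ∀ η, ‖L η‖ ≤ (C * A : ℝ≥0) * ‖gradL2 η‖ := by
    intro η
    have h1 : ‖L η‖ₑ ≤ (C * A : ℝ≥0) * ‖gradL2 η‖ₑ := by
      have e : ‖L η‖ₑ = ‖∫ x, (η : R3 → ℝ) x * f x‖ₑ := enorm_neg (∫ x, (η : R3 → ℝ) x * f x)
      rw [e, enorm_gradL2, ENNReal.coe_mul, mul_right_comm]
      exact (hA η).trans (by gcongr; exact hC _ η.2)
    rw [← coe_nnnorm, ← coe_nnnorm]
    simp only [enorm_eq_nnnorm] at h1
    exact_mod_cast h1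
  obtain ⟨F, hF⟩ := exists_inner_eq_of_norm_le gradL2 L _ hL
  refine ⟨F, locallyIntegrable_coe _, hf.locallyIntegrable one_le_six_fifths, fun η hη => ?_⟩
  rw [← inner_gradL2 _ ⟨η, hη⟩, hF]
  simp only [L, LinearMap.coe_mk, AddHom.coe_mk, mul_comm]

/-- Integration by parts for two test functions. -/
theorem IsTest.isWeakGradient {η : R3 → ℝ} (h : IsTest η) : IsWeakGradient η (∇ η) := by
  refine ⟨h.continuous.locallyIntegrable, h.continuous_gradient.locallyIntegrable,
    fun ζ hζ => ?_⟩
  have hint : ∀ {a b : R3 → ℝ}, IsTest a → IsTest b → Integrable fun x => a x • ∇ b x :=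
    fun ha hb => (ha.continuous.smul hb.continuous_gradient).integrable_of_hasCompactSupport
      hb.hasCompactSupport_gradient.smul_left
  have hd : ∀ {a b : R3 → ℝ} (v x : R3), ⟪a x • ∇ b x, v⟫ = a x * fderiv ℝ b x v :=
    fun v x => by rw [real_inner_smul_left, inner_gradient_left]
  have hint' : ∀ {a b : R3 → ℝ} (v : R3), IsTest a → IsTest b →
      Integrable fun x => a x * fderiv ℝ b x v := fun v ha hb => by
    simpa only [hd] using (hint ha hb).inner_const (𝕜 := ℝ) v
  refine ext_inner_left ℝ fun v => ?_
  rw [inner_neg_right, ← integral_inner (hint h hζ), ← integral_inner (hint hζ h)]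
  simp_rw [real_inner_comm _ v, hd]
  rw [integral_mul_fderiv_eq_neg_fderiv_mul_of_integrable (μ := volume)
    (by simpa only [mul_comm] using hint' v hζ h) (hint' v h hζ)
    ((h.continuous.mul hζ.continuous).integrable_of_hasCompactSupport hζ.2.mul_left)
    (fun x _ => h.differentiable x) (fun x _ => hζ.differentiable x)]
  simp only [mul_comm]

/-- A field in `L²` which is orthogonal to all divergence-free fields is the gradient of a function
in `𝒟^{1,2}`. -/
theorem exists_potential {E : L2Vec}
    (hE : ∀ F : L2Vec, IsWeakDivergence F (fun _ => 0) → ⟪E, F⟫ = 0) :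
    ∃ φ : R3 → ℝ, MemD12 φ ∧ IsWeakGradient φ E ∧
      ∀ (F : L2Vec) (f : R3 → ℝ), MemLp f (6 / 5) → IsWeakDivergence F f →
        ⟪E, F⟫ = - ∫ x, φ x * f x := by
  obtain ⟨C, hC⟩ := exists_sobolev_const
  have : Fact ((1 : ℝ≥0∞) ≤ 6) := ⟨by norm_num⟩
  -- A field orthogonal to the gradients of all test functions is divergence-free, so `E` lies in
  -- the double orthogonal complement, that is, in the closure of those gradients.
  have hcl : E ∈ (LinearMap.range gradL2).topologicalClosure := by
    rw [← Submodule.orthogonal_orthogonal_eq_closure, Submodule.mem_orthogonal]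
    intro F hF
    rw [real_inner_comm]
    refine hE F ⟨locallyIntegrable_coe _, (integrable_zero _ _ _).locallyIntegrable,
      fun η hη => ?_⟩
    rw [Submodule.mem_orthogonal'] at hF
    rw [← inner_gradL2 F ⟨η, hη⟩, hF _ ⟨_, rfl⟩]
    simp
  rw [← SetLike.mem_coe, Submodule.topologicalClosure_coe, mem_closure_iff_seq_limit] at hcl
  obtain ⟨y, hy, hlim⟩ := hcl
  choose η hη using hy
  obtain rfl : y = fun n => gradL2 (η n) := funext fun n => (hη n).symm
  let Φ : ℕ → Lp ℝ 6 (volume : Measure R3) := fun n => ((η n).2.memLp 6).toLp (η n : R3 → ℝ)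
  -- By Sobolev, convergence of the gradients in `L²` makes the functions Cauchy in `L⁶`; their
  -- limit is the potential.
  have hΦ : ∀ i j, Dist.dist (Φ i) (Φ j) ≤ C * Dist.dist (gradL2 (η i)) (gradL2 (η j)) := by
    intro i j
    have h1 : edist (Φ i) (Φ j) ≤ C * edist (gradL2 (η i)) (gradL2 (η j)) := by
      rw [Lp.edist_toLp_toLp, edist_eq_enorm_sub, ← map_sub, enorm_gradL2]
      exact hC _ (η i - η j).2
    rw [dist_edist, dist_edist]
    have := ENNReal.toReal_mono (ENNReal.mul_ne_top (by simp) (edist_ne_top _ _)) h1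
    simpa using this
  have hcauchy : CauchySeq Φ := by
    rw [Metric.cauchySeq_iff']
    intro ε hε
    -- `C + 1` avoids division by zero, since `C` may vanish.
    obtain ⟨N, hN⟩ := Metric.cauchySeq_iff'.1 hlim.cauchySeq (ε / (C + 1)) (by positivity)
    refine ⟨N, fun n hn => (hΦ n N).trans_lt ?_⟩
    have h2 := hN n hn
    rw [lt_div_iff₀ (by positivity)] at h2
    linarith [dist_nonneg (x := gradL2 (η n)) (y := gradL2 (η N))]
  obtain ⟨φ, hφ⟩ := cauchySeq_tendsto_of_complete hcauchy
  have hφm : MemLp φ 6 := Lp.memLp φ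
  have l6 : Tendsto (fun n => eLpNorm ((η n : R3 → ℝ) - (φ : R3 → ℝ)) 6) atTop (𝓝 0) := by
    rw [← Lp.tendsto_Lp_iff_tendsto_eLpNorm'' (fun n => (η n : R3 → ℝ))
      (fun n => (η n).2.memLp 6) φ hφm, Lp.toLp_coeFn]
    exact hφ
  have l2 : Tendsto (fun n => eLpNorm (∇ (η n : R3 → ℝ) - (E : R3 → R3)) 2) atTop (𝓝 0) := by
    rw [← Lp.tendsto_Lp_iff_tendsto_eLpNorm'' (fun n => ∇ (η n : R3 → ℝ))
      (fun n => (η n).2.memLp_gradient 2) E (Lp.memLp E), Lp.toLp_coeFn]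
    exact hlim
  refine ⟨φ, ⟨hφm, E, Lp.memLp E, fun n => η n, fun n => (η n).2, l6, l2⟩,
    ⟨hφm.locallyIntegrable (by norm_num), locallyIntegrable_coe _, fun ζ hζ => ?_⟩, ?_⟩
  -- Integration by parts for `η n` passes to the limit: one side pairs `L⁶` with `L^{6/5}`, the
  -- other `L²` with `L²`.
  · have t1 := tendsto_integral_smul_left (p := 6) (q := 6 / 5)
      (fun n => (η n).2.memLp 6) hφm (hζ.memLp_gradient (6 / 5)) l6
    have t2 := tendsto_integral_smul_right (p := 2) (q := 2) (hζ.memLp 2)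
      (fun n => (η n).2.memLp_gradient 2) (Lp.memLp E) l2
    refine tendsto_nhds_unique t1 (t2.neg.congr fun n => ?_)
    exact ((IsTest.isWeakGradient (η n).2).2.2 ζ hζ).symm
  · intro F f hf hF
    have t1 := tendsto_integral_smul_left (p := 6) (q := 6 / 5)
      (fun n => (η n).2.memLp 6) hφm hf l6
    have t2 : Tendsto (fun n => ⟪gradL2 (η n), F⟫) atTop (𝓝 ⟪E, F⟫) :=
      hlim.inner tendsto_const_nhds
    refine tendsto_nhds_unique t2 (t1.neg.congr fun n => ?_)
    rw [real_inner_comm, inner_gradL2, hF.2.2 _ (η n).2]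
    simp only [smul_eq_mul, mul_comm]

/-! ### Linear combinations of weak gradients and divergences -/

theorem IsWeakGradient.congr {f f' : R3 → ℝ} {G G' : R3 → R3} (h : IsWeakGradient f G)
    (hf : f =ᵐ[volume] f') (hG : G =ᵐ[volume] G') : IsWeakGradient f' G' := by
  refine ⟨h.1.congr hf, h.2.1.congr hG, fun η hη => ?_⟩
  rw [← integral_congr_ae (f := fun x => f x • ∇ η x)
      (by filter_upwards [hf] with x hx; rw [hx]), h.2.2 η hη,
    integral_congr_ae (f := fun x => η x • G x) (by filter_upwards [hG] with x hx; rw [hx])]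

theorem IsWeakDivergence.congr_right {F : R3 → R3} {f f' : R3 → ℝ} (h : IsWeakDivergence F f)
    (hf : f =ᵐ[volume] f') : IsWeakDivergence F f' := by
  refine ⟨h.1, h.2.1.congr hf, fun η hη => ?_⟩
  rw [h.2.2 η hη, integral_congr_ae (f := fun x => f x * η x)
    (by filter_upwards [hf] with x hx; rw [hx])]

theorem IsWeakGradient.add_smul {f g : R3 → ℝ} {F G : R3 → R3} (hf : IsWeakGradient f F)
    (hg : IsWeakGradient g G) (t : ℝ) : IsWeakGradient (f + t • g) (F + t • G) := by
  refine ⟨hf.1.add (hg.1.smul t), hf.2.1.add (hg.2.1.smul t), fun η hη => ?_⟩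
  have i : ∀ {a : R3 → ℝ}, LocallyIntegrable a → Integrable fun x => a x • ∇ η x := fun ha =>
    ha.integrable_smul_right_of_hasCompactSupport hη.continuous_gradient
      hη.hasCompactSupport_gradient
  have j : ∀ {A : R3 → R3}, LocallyIntegrable A → Integrable fun x => η x • A x := fun hA =>
    hA.integrable_smul_left_of_hasCompactSupport hη.continuous hη.2
  have e1 : ∀ x, (f + t • g) x • ∇ η x = f x • ∇ η x + t • (g x • ∇ η x) := fun x => by
    rw [Pi.add_apply, Pi.smul_apply, _root_.add_smul, smul_assoc]
  have e2 : ∀ x, η x • (F + t • G) x = η x • F x + t • (η x • G x) := fun x => by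
    rw [Pi.add_apply, Pi.smul_apply, smul_add, smul_comm]
  simp_rw [e1, e2]
  rw [integral_add (i hf.1) (Integrable.fun_smul t (i hg.1)), integral_smul, hf.2.2 η hη,
    hg.2.2 η hη, integral_add (j hf.2.1) (Integrable.fun_smul t (j hg.2.1)), integral_smul,
    smul_neg, neg_add]

theorem IsWeakDivergence.smul_add_smul {F G : L2Vec} {f g : R3 → ℝ} (hF : IsWeakDivergence F f)
    (hG : IsWeakDivergence G g) (s t : ℝ) :
    IsWeakDivergence (s • (F + t • G) : L2Vec) (s • (f + t • g)) := by
  refine ⟨locallyIntegrable_coe _, ?_, fun η hη => ?_⟩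
  · exact (hF.2.1.add (hG.2.1.smul t)).smul s
  have i : ∀ {a : R3 → ℝ}, LocallyIntegrable a → Integrable fun x => a x * η x := fun ha =>
    ha.integrable_smul_right_of_hasCompactSupport hη.continuous hη.2
  have h1 := hF.2.2 η hη
  have h2 := hG.2.2 η hη
  rw [← inner_gradL2 _ ⟨η, hη⟩] at h1 h2 ⊢
  rw [real_inner_smul_left, inner_add_left, real_inner_smul_left, h1, h2]
  simp only [Pi.add_apply, Pi.smul_apply, smul_eq_mul, mul_assoc, add_mul]
  rw [integral_const_mul, integral_add (i hF.2.1) ((i hG.2.1).const_mul t), integral_const_mul]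
  ring

/-! ### Variations of a minimizer -/

/-- A test function, as an element of `L²`. -/
def IsTest.toL2 {η : R3 → ℝ} (h : IsTest η) : L2 := (h.memLp 2).toLp η

theorem IsTest.coeFn_toL2 {η : R3 → ℝ} (h : IsTest η) : h.toL2 =ᵐ[volume] η :=
  (h.memLp 2).coeFn_toLp

theorem inner_toL2 (f : L2) {η : R3 → ℝ} (h : IsTest η) : ⟪f, h.toL2⟫ = ∫ x, f x * η x := by
  rw [L2.inner_def]
  refine integral_congr_ae ?_
  filter_upwards [h.coeFn_toL2] with x hx
  rw [hx, real_inner_comm]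
  rfl

theorem integrable_mul_coe (f : L2) {g : R3 → ℝ} (h : MemLp g 2) :
    Integrable fun x => f x * g x :=
  (Lp.memLp f).integrable_mul h

theorem coeFn_add_smul {F : Type*} [NormedAddCommGroup F] [NormedSpace ℝ F]
    (f g : Lp F 2 (volume : Measure R3)) (t : ℝ) :
    (f + t • g : Lp F 2 (volume : Measure R3)) =ᵐ[volume] fun x => f x + t • g x := by
  filter_upwards [Lp.coeFn_add f (t • g), Lp.coeFn_smul t g] with x h1 h2
  rw [h1, Pi.add_apply, h2, Pi.smul_apply]

/-- The variation of a configuration used to derive the Euler-Lagrange equations. -/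
def vary (z : Config) {ψ ξ : R3 → ℝ} (hψ : IsTest ψ) (hξ : IsTest ξ) (F : L2Vec) (s t : ℝ) :
    Config where
  u := z.u + t • hξ.toL2
  gradU := z.gradU + t • gradL2 ⟨ξ, hξ⟩
  uHat := z.uHat
  -- The same factor multiplies `θ` and `E`: Gauss's law is linear in this pair for fixed `u`, so it
  -- survives the scaling that corrects the charge.
  theta := s • (z.theta + t • hψ.toL2)
  Theta := z.Theta
  E := s • (z.E + t • F)
  H := z.H
  isWeakGradient := by
    refine (z.isWeakGradient.add_smul hξ.isWeakGradient t).congr ?_ ?_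
    · filter_upwards [coeFn_add_smul z.u hξ.toL2 t, hξ.coeFn_toL2] with x h1 h2
      rw [h1, h2]
      rfl
    · filter_upwards [coeFn_add_smul z.gradU (gradL2 ⟨ξ, hξ⟩) t, coeFn_gradL2 ⟨ξ, hξ⟩]
        with x h1 h2
      rw [h1, h2]
      rfl

section Vary

variable (z : Config) {ψ ξ : R3 → ℝ} (hψ : IsTest ψ) (hξ : IsTest ξ) (F : L2Vec) (s t : ℝ)

theorem coeFn_add_smul_toL2 (f : L2) :
    (f + t • hξ.toL2 : L2) =ᵐ[volume] fun x => f x + t * ξ x := by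
  filter_upwards [coeFn_add_smul f hξ.toL2 t, hξ.coeFn_toL2] with x h1 h2
  rw [h1, h2, smul_eq_mul]

/-- The condition `ψ ξ = 0` removes the `t²` term, so a single `F`, independent of `t`, corrects
Gauss's law. -/
theorem vary_theta_mul_u (hψξ : ∀ x, ψ x * ξ x = 0) :
    ∀ᵐ x, (vary z hψ hξ F s t).theta x * (vary z hψ hξ F s t).u x =
      s * (z.theta x * z.u x + t * (ψ x * z.u x + z.theta x * ξ x)) := by
  filter_upwards [coeFn_add_smul_toL2 hξ t z.u, coeFn_add_smul_toL2 hψ t z.theta,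
    Lp.coeFn_smul s (z.theta + t • hψ.toL2)] with x h1 h2 h3
  simp only [vary, h1, h3, Pi.smul_apply, h2, smul_eq_mul]
  linear_combination s * t ^ 2 * hψξ x

theorem charge_vary (hψξ : ∀ x, ψ x * ξ x = 0) :
    charge (vary z hψ hξ F s t) =
      s * (charge z + t * ∫ x, ψ x * z.u x + z.theta x * ξ x) := by
  have i1 : Integrable fun x => ψ x * z.u x := by
    simpa only [mul_comm] using integrable_mul_coe z.u (hψ.memLp 2)
  have i2 : Integrable fun x => ψ x * z.u x + z.theta x * ξ x :=
    i1.add (integrable_mul_coe z.theta (hξ.memLp 2))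
  rw [charge, integral_congr_ae (vary_theta_mul_u z hψ hξ F s t hψξ), integral_const_mul,
    integral_add (integrable_mul_coe z.theta (Lp.memLp z.u))
      (i2.const_mul t), integral_const_mul]
  rfl

theorem isWeakDivergence_vary {q : ℝ} (hψξ : ∀ x, ψ x * ξ x = 0)
    (hz : IsWeakDivergence z.E fun x => q * z.theta x * z.u x)
    (hF : IsWeakDivergence F fun x => q * (ψ x * z.u x + z.theta x * ξ x)) :
    IsWeakDivergence (vary z hψ hξ F s t).E
      fun x => q * (vary z hψ hξ F s t).theta x * (vary z hψ hξ F s t).u x := by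
  refine (hz.smul_add_smul hF s t).congr_right ?_
  filter_upwards [vary_theta_mul_u z hψ hξ F s t hψξ] with x hx
  rw [mul_assoc, hx]
  simp only [Pi.add_apply, Pi.smul_apply, smul_eq_mul]
  ring

theorem energy_vary (W : ℝ → ℝ) (m : ℝ) :
    energy W m (vary z hψ hξ F s t) =
      1 / 2 * (‖z.uHat‖ ^ 2 + ‖z.gradU + t • gradL2 ⟨ξ, hξ⟩‖ ^ 2
        + m ^ 2 * ‖z.u + t • hξ.toL2‖ ^ 2 + s ^ 2 * ‖z.theta + t • hψ.toL2‖ ^ 2 + ‖z.Theta‖ ^ 2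
        + s ^ 2 * ‖z.E + t • F‖ ^ 2 + ‖z.H‖ ^ 2) + ∫ x, nonlin W m (z.u x + t * ξ x) := by
  have e : ∫ x, nonlin W m ((vary z hψ hξ F s t).u x) = ∫ x, nonlin W m (z.u x + t * ξ x) := by
    refine integral_congr_ae ?_
    filter_upwards [coeFn_add_smul_toL2 hξ t z.u] with x hx
    simp only [vary, hx]
  rw [energy, e]
  simp only [vary, norm_smul, mul_pow, Real.norm_eq_abs, sq_abs]

end Vary

theorem hasDerivAt_norm_add_smul_sq {H : Type*} [NormedAddCommGroup H] [InnerProductSpace ℝ H]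
    (a b : H) : HasDerivAt (fun t : ℝ => ‖a + t • b‖ ^ 2) (2 * ⟪a, b⟫) 0 := by
  have h : HasDerivAt (fun t : ℝ => a + t • b) b 0 := by
    simpa using ((hasDerivAt_id (0 : ℝ)).smul_const b).const_add a
  simpa using h.norm_sq

variable {W : ℝ → ℝ} {m q : ℝ}

/-- `z` minimizes the energy among the states with the same `|C|`. -/
def IsMinimizer (W : ℝ → ℝ) (m : ℝ) (z : PhaseSpace q) : Prop :=
  ∀ w : PhaseSpace q, |charge w.1| = |charge z.1| → energy W m z.1 ≤ energy W m w.1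

/-- The Euler-Lagrange equation, in weak form. -/
theorem IsMinimizer.euler_lagrange {z : PhaseSpace q} (hz : IsMinimizer W m z)
    (hW : IsAdmissible W m) (hc : charge z.1 ≠ 0) {ψ ξ : R3 → ℝ} (hψ : IsTest ψ) (hξ : IsTest ξ)
    (hψξ : ∀ x, ψ x * ξ x = 0) {F : L2Vec}
    (hF : IsWeakDivergence F fun x => q * (ψ x * z.1.u x + z.1.theta x * ξ x)) :
    (∫ x, ⟪z.1.gradU x, ∇ ξ x⟫) + (∫ x, deriv W (z.1.u x) * ξ x)
      + (∫ x, z.1.theta x * ψ x) + ⟪z.1.E, F⟫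
      = (‖z.1.theta‖ ^ 2 + ‖z.1.E‖ ^ 2) / charge z.1
        * ∫ x, ψ x * z.1.u x + z.1.theta x * ξ x := by
  set c := charge z.1
  set b := ∫ x, ψ x * z.1.u x + z.1.theta x * ξ x with hb
  have h6 : MemLp z.1.u 6 := memLp_six_of_isWeakGradient z.1.isWeakGradient
  have h2 : MemLp z.1.u 2 := Lp.memLp _
  -- Chosen so that `s(t)(c + tb) = c`: the charge is preserved whenever `c + tb ≠ 0`.
  let s : ℝ → ℝ := fun t => c / (c + t * b)
  have hs0 : s 0 = 1 := by simp [s, hc]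
  have hs : HasDerivAt s (-(b / c)) 0 := by
    have h1 : HasDerivAt (fun t : ℝ => c + t * b) b 0 := by
      simpa using ((hasDerivAt_id (0 : ℝ)).mul_const b).const_add c
    refine ((hasDerivAt_const (0 : ℝ) c).div h1 (by simpa using hc)).congr_deriv ?_
    simp
    field_simp
  have hs2 : HasDerivAt (fun t => s t ^ 2) (-(2 * (b / c))) 0 := by
    refine (hs.pow 2).congr_deriv ?_
    simp [hs0]
  let J : ℝ → ℝ := fun t => energy W m (vary z.1 hψ hξ F (s t) t)
  have hJ0 : J 0 = energy W m z.1 := by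
    simp only [J, energy_vary, hs0]
    simp [energy]
  have hmin : IsLocalMin J 0 := by
    have hne : ∀ᶠ t : ℝ in 𝓝 0, c + t * b ≠ 0 := by
      have : ContinuousAt (fun t : ℝ => c + t * b) 0 := by fun_prop
      exact this.eventually_ne (by simpa using hc)
    filter_upwards [hne] with t ht
    rw [hJ0]
    refine hz ⟨_, isWeakDivergence_vary z.1 hψ hξ F (s t) t hψξ z.2.1 hF, z.2.2⟩ ?_
    congr 1
    refine (charge_vary z.1 hψ hξ F (s t) t hψξ).trans ?_
    exact div_mul_cancel₀ c ht
  have hJ := ((((((((hasDerivAt_const (0 : ℝ) (‖z.1.uHat‖ ^ 2)).add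
    (hasDerivAt_norm_add_smul_sq z.1.gradU (gradL2 ⟨ξ, hξ⟩))).add
    ((hasDerivAt_norm_add_smul_sq z.1.u hξ.toL2).const_mul (m ^ 2))).add
    (hs2.mul (hasDerivAt_norm_add_smul_sq z.1.theta hψ.toL2))).add
    (hasDerivAt_const (0 : ℝ) (‖z.1.Theta‖ ^ 2))).add
    (hs2.mul (hasDerivAt_norm_add_smul_sq z.1.E F))).add
    (hasDerivAt_const (0 : ℝ) (‖z.1.H‖ ^ 2))).const_mul (1 / 2)).add
    (hW.hasDerivAt_integral_nonlin h2 h6 (hξ.memLp 2) (hξ.memLp 6))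
  have hJ' : HasDerivAt J _ 0 := hJ.congr_of_eventuallyEq
    (Eventually.of_forall fun t => energy_vary z.1 hψ hξ F (s t) t W m)
  have key := hmin.hasDerivAt_eq_zero hJ'
  simp only [hs0, zero_smul, add_zero] at key
  rw [inner_gradL2, inner_toL2, inner_toL2] at key
  have iu : Integrable fun x => z.1.u x * ξ x := integrable_mul_coe _ (hξ.memLp 2)
  have iW : Integrable fun x => deriv W (z.1.u x) * ξ x :=
    (hW.locallyIntegrable_deriv h2 h6).integrable_smul_right_of_hasCompactSupport hξ.continuous hξ.2
  -- The derivative of `N` contributes `W'(u) - m²u`; its mass part cancels the derivative of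
  -- `½m²‖u‖²`.
  have e : ∫ x, (deriv W (z.1.u x) - m ^ 2 * z.1.u x) * ξ x
      = (∫ x, deriv W (z.1.u x) * ξ x) - m ^ 2 * ∫ x, z.1.u x * ξ x := by
    simp only [sub_mul, mul_assoc]
    rw [integral_sub iW (iu.const_mul _), integral_const_mul]
  rw [e] at key
  field_simp at key ⊢
  linarith

/-! ### Elementary properties of minimizers -/

/-- The mass term and `∫ N(u)` recombine into `∫ W(u)`, which is nonnegative; the other terms are
squares. -/
theorem IsAdmissible.energy_nonneg (hW : IsAdmissible W m) (z : Config) : 0 ≤ energy W m z := by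
  have h6 : MemLp z.u 6 := memLp_six_of_isWeakGradient z.isWeakGradient
  have h2 : MemLp z.u 2 := Lp.memLp _
  have e : ‖z.u‖ ^ 2 = ∫ x, z.u x * z.u x := by
    rw [← real_inner_self_eq_norm_sq, L2.inner_def]
    rfl
  have hp : 0 ≤ 1 / 2 * m ^ 2 * ‖z.u‖ ^ 2 + ∫ x, nonlin W m (z.u x) := by
    rw [e, ← integral_const_mul, ← integral_add ((integrable_mul_coe z.u h2).const_mul _)
      (hW.integrable_nonlin h2 h6)]
    refine integral_nonneg fun x => ?_
    have := hW.nonneg (z.u x)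
    simp only [nonlin, Pi.zero_apply]
    nlinarith
  rw [energy]
  nlinarith [sq_nonneg ‖z.uHat‖, sq_nonneg ‖z.gradU‖, sq_nonneg ‖z.theta‖, sq_nonneg ‖z.Theta‖,
    sq_nonneg ‖z.E‖, sq_nonneg ‖z.H‖]

theorem charge_zero : charge 0 = 0 := by
  refine integral_eq_zero_of_ae (ae_of_all _ fun x => ?_)
  change (0 : L2) x * (0 : L2) x = 0
  simp

theorem IsAdmissible.energy_zero (hW : IsAdmissible W m) : energy W m 0 = 0 := by
  have h : ∫ x, nonlin W m ((0 : Config).u x) = 0 := by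
    refine integral_eq_zero_of_ae (ae_of_all _ fun x => ?_)
    change nonlin W m ((0 : L2) x) = 0
    simp [nonlin, hW.zero]
  rw [energy, h]
  change 1 / 2 * (‖(0 : L2)‖ ^ 2 + ‖(0 : L2Vec)‖ ^ 2 + m ^ 2 * ‖(0 : L2)‖ ^ 2 + ‖(0 : L2)‖ ^ 2
    + ‖(0 : L2Vec)‖ ^ 2 + ‖(0 : L2Vec)‖ ^ 2 + ‖(0 : L2Vec)‖ ^ 2) + 0 = 0
  simp

theorem IsStandingHylomorphicSoliton.isMinimizer {γ : ℝ → PhaseSpace q → PhaseSpace q}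
    {z : PhaseSpace q} (h : IsStandingHylomorphicSoliton W m γ z) : IsMinimizer W m z := by
  obtain ⟨e₀, c₀, hmin, ⟨he, hc⟩, -⟩ := h
  intro w hw
  rw [he]
  exact hmin.2 ⟨w, hw.trans hc, rfl⟩

/-- At zero charge the zero state competes, forcing the minimal energy to be `0`; the zero state
would then belong to `Γ`. -/
theorem IsStandingHylomorphicSoliton.charge_ne_zero {γ : ℝ → PhaseSpace q → PhaseSpace q}
    {z : PhaseSpace q} (h : IsStandingHylomorphicSoliton W m γ z) (hW : IsAdmissible W m) :
    charge z.1 ≠ 0 := by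
  have hm := h.isMinimizer
  obtain ⟨e₀, c₀, -, ⟨he, hc⟩, -, -, -, h0⟩ := h
  intro hz
  have hle : energy W m z.1 ≤ energy W m 0 := hm 0 (by rw [hz]; exact congrArg abs charge_zero)
  rw [hW.energy_zero] at hle
  refine h0 ⟨?_, ?_⟩
  · rw [← he, le_antisymm hle (hW.energy_nonneg z.1)]
    exact hW.energy_zero
  · rw [← hc, hz]
    exact congrArg abs charge_zero

/-- The components which do not enter the constraints vanish at a minimizer. -/
theorem IsMinimizer.eq_zero {z : PhaseSpace q} (hz : IsMinimizer W m z) :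
    z.1.uHat = 0 ∧ z.1.Theta = 0 ∧ z.1.H = 0 := by
  -- Neither the charge nor Gauss's law involves the three components set to zero, and `H = 0` is
  -- divergence-free.
  have h := hz ⟨{ z.1 with uHat := 0, Theta := 0, H := 0 }, z.2.1, (0 : PhaseSpace q).2.2⟩ rfl
  simp only [energy, norm_zero] at h
  refine ⟨norm_eq_zero.1 ?_, norm_eq_zero.1 ?_, norm_eq_zero.1 ?_⟩ <;>
  · refine pow_eq_zero_iff two_ne_zero |>.1 (le_antisymm ?_ (sq_nonneg _))
    nlinarith [sq_nonneg ‖z.1.uHat‖, sq_nonneg ‖z.1.Theta‖, sq_nonneg ‖z.1.H‖]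

/-! ### Splitting the Euler-Lagrange identity into separate equations -/

theorem memLp_six_fifths_mul (f : L2) {η : R3 → ℝ} (h : IsTest η) (q : ℝ) :
    MemLp (fun x => q * (f x * η x)) (6 / 5) :=
  -- Since `1/2 + 1/3 = 5/6`, the product lies in the space on which the divergence equation is
  -- solvable and the pairing with `φ ∈ L⁶` makes sense.
  ((h.memLp 3).mul' (r := 6 / 5) (Lp.memLp f)).const_mul q

theorem locallyIntegrable_mul_six {φ : R3 → ℝ} (hφ : MemLp φ 6) (f : L2) :
    LocallyIntegrable fun x => φ x * f x := by
  refine ((Lp.memLp f).mul' (r := 3 / 2) hφ).locallyIntegrable ?_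
  rw [ENNReal.le_div_iff_mul_le (by simp) (by simp)]
  norm_num

theorem WeaklySolves.congr {f h h' : R3 → ℝ} (hf : WeaklySolves f h) (hh : h =ᵐ[volume] h') :
    WeaklySolves f h' := by
  obtain ⟨hl, G, hG, hint⟩ := hf
  refine ⟨hl.congr hh, G, hG, fun η hη => ?_⟩
  rw [← hint η hη, integral_congr_ae (f := fun x => h x * η x)
    (by filter_upwards [hh] with x hx; rw [hx])]

/-- The Euler-Lagrange equations for a minimizer: with `E = -∇φ`, one has `θ = (λ - q φ) u`, and
`u` solves `-Δ u + W'(u) = (λ - q φ) θ`. -/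
theorem IsMinimizer.exists_multiplier {z : PhaseSpace q} (hz : IsMinimizer W m z)
    (hW : IsAdmissible W m) (hc : charge z.1 ≠ 0) :
    ∃ (φ : R3 → ℝ) (l : ℝ), MemD12 φ ∧ IsWeakGradient φ (fun x => -(z.1.E x)) ∧
      (∀ᵐ x, z.1.theta x = (l - q * φ x) * z.1.u x) ∧
      WeaklySolves z.1.u
        (fun x => deriv W (z.1.u x) - (l - q * φ x) * z.1.theta x) := by
  have h6 : MemLp z.1.u 6 := memLp_six_of_isWeakGradient z.1.isWeakGradient
  have h2 : MemLp z.1.u 2 := Lp.memLp _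
  -- With `ψ = ξ = 0` the identity reduces to `⟪E, F⟫ = 0`. The sign is changed so that the
  -- potential satisfies `∇φ = -E`.
  have hE : ∀ F : L2Vec, IsWeakDivergence F (fun _ => 0) → ⟪-z.1.E, F⟫ = 0 := by
    intro F hF
    have h := hz.euler_lagrange hW hc IsTest.zero IsTest.zero (by simp) (F := F)
      (by simpa using hF)
    have hg : ∇ (0 : R3 → ℝ) = 0 := by
      ext1 x
      exact gradient_fun_const x 0
    simpa [hg] using h
  obtain ⟨φ, hφ, hgrad, hpair⟩ := exists_potential hE
  have hpair' : ∀ (F : L2Vec) (f : R3 → ℝ), MemLp f (6 / 5) → IsWeakDivergence F f →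
      ⟪z.1.E, F⟫ = ∫ x, φ x * f x := fun F f hf hF => by
    have := hpair F f hf hF
    rw [inner_neg_left] at this
    exact neg_injective this
  set l := (‖z.1.theta‖ ^ 2 + ‖z.1.E‖ ^ 2) / charge z.1
  have loc : ∀ f : L2, LocallyIntegrable fun x => (l - q * φ x) * f x := fun f => by
    have h1 := ((locallyIntegrable_coe f).smul l).sub
      ((locallyIntegrable_mul_six hφ.1 f).smul q)
    refine h1.congr (ae_of_all _ fun x => ?_)
    simp only [Pi.sub_apply, Pi.smul_apply, smul_eq_mul]
    ring
  have int : ∀ {f : R3 → ℝ} {η : R3 → ℝ}, LocallyIntegrable f → IsTest η →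
      Integrable fun x => f x * η x := fun hf hη =>
    hf.integrable_smul_right_of_hasCompactSupport hη.continuous hη.2
  have hsplit : ∀ (f : L2) {η : R3 → ℝ}, IsTest η →
      ∫ x, (l - q * φ x) * f x * η x
        = l * (∫ x, f x * η x) - ∫ x, φ x * (q * (f x * η x)) := fun f η hη => by
    rw [← integral_const_mul, ← integral_sub]
    · refine integral_congr_ae (ae_of_all _ fun x => ?_)
      ring
    · exact (int (locallyIntegrable_coe f) hη).const_mul l
    · refine ((int (locallyIntegrable_mul_six hφ.1 f) hη).const_mul q).congr
        (ae_of_all _ fun x => ?_)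
      ring
  refine ⟨φ, l, hφ, hgrad.congr (ae_eq_refl _) (Lp.coeFn_neg z.1.E), ?_, ?_⟩
  -- Taking `ξ = 0` leaves an identity linear in an arbitrary test function `ψ`, which forces the
  -- pointwise relation.
  · have h0 : ∀ᵐ x, z.1.theta x - (l - q * φ x) * z.1.u x = 0 := by
      refine ae_eq_zero_of_integral_contDiff_smul_eq_zero
        ((locallyIntegrable_coe z.1.theta).sub (loc z.1.u)) fun ψ hψ1 hψ2 => ?_
      have hψ : IsTest ψ := ⟨hψ1, hψ2⟩
      have hf := memLp_six_fifths_mul z.1.u hψ q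
      obtain ⟨F, hF⟩ := exists_isWeakDivergence hf
      have hEL := hz.euler_lagrange hW hc hψ IsTest.zero (by simp) (F := F)
        (by simpa [mul_comm] using hF)
      have hg : ∇ (0 : R3 → ℝ) = 0 := by
        ext1 x
        exact gradient_fun_const x 0
      rw [hpair' F _ hf hF] at hEL
      simp only [hg, Pi.zero_apply, inner_zero_right, mul_zero, integral_zero, add_zero,
        zero_add] at hEL
      simp only [smul_eq_mul, mul_sub]
      rw [integral_sub (by simpa only [mul_comm] using int (locallyIntegrable_coe z.1.theta) hψ)
        (by simpa only [mul_comm] using int (loc z.1.u) hψ)]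
      simp only [mul_comm (ψ _)] at hEL ⊢
      rw [hsplit z.1.u hψ]
      linarith
    filter_upwards [h0] with x hx
    exact sub_eq_zero.1 hx
  -- Taking `ψ = 0` leaves the weak equation for `u`, tested against `ξ`.
  · refine ⟨(hW.locallyIntegrable_deriv h2 h6).sub (loc z.1.theta), z.1.gradU,
      z.1.isWeakGradient, fun ξ hξ => ?_⟩
    have hf := memLp_six_fifths_mul z.1.theta hξ q
    obtain ⟨F, hF⟩ := exists_isWeakDivergence hf
    have hEL := hz.euler_lagrange hW hc IsTest.zero hξ (by simp) (F := F) (by simpa using hF)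
    rw [hpair' F _ hf hF] at hEL
    simp only [Pi.zero_apply, mul_zero, zero_mul, integral_zero, add_zero, zero_add] at hEL
    simp only [sub_mul _ _ (ξ _)]
    rw [integral_sub (int (hW.locallyIntegrable_deriv h2 h6) hξ) (int (loc z.1.theta) hξ),
      hsplit z.1.theta hξ]
    linarith

end NKGM

end

theorem mainTheorem5 (W : ℝ → ℝ) (m q : ℝ) (hW : NKGM.IsAdmissible W m) (hq : 0 ≤ q)
    (γ : ℝ → NKGM.PhaseSpace q → NKGM.PhaseSpace q) (z : NKGM.PhaseSpace q)
    (hz : NKGM.IsStandingHylomorphicSoliton W m γ z) :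
    z.1.uHat = 0 ∧ z.1.Theta = 0 ∧ z.1.H = 0 ∧
    (∀ᵐ x, z.1.u x = 0 → z.1.theta x = 0) ∧
    ∃ φ : NKGM.R3 → ℝ, NKGM.MemD12 φ ∧
      NKGM.IsWeakGradient φ (fun x => -(z.1.E x)) ∧
      NKGM.WeaklySolves z.1.u
        (fun x => deriv W (z.1.u x) - z.1.theta x ^ 2 / z.1.u x) ∧
      NKGM.WeaklySolves φ (fun x => -(q * z.1.theta x * z.1.u x)) := by
  have hmin := hz.isMinimizer
  obtain ⟨h1, h2, h3⟩ := hmin.eq_zero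
  obtain ⟨φ, l, hφ, hgrad, hθ, hu⟩ := hmin.exists_multiplier hW (hz.charge_ne_zero hW)
  refine ⟨h1, h2, h3, ?_, φ, hφ, hgrad, hu.congr ?_, z.2.1.2.1.neg, _, hgrad, fun η hη => ?_⟩
  · filter_upwards [hθ] with x hx h0
    rw [hx, h0, mul_zero]
  -- Off `{u = 0}`, `(l - qφ)θ = (l - qφ)²u = θ²/u`. On `{u = 0}`, `θ` vanishes, and `x / 0 = 0`
  -- agrees with the convention for `θ²/u`.
  · filter_upwards [hθ] with x hx
    rcases eq_or_ne (z.1.u x) 0 with h0 | h0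
    · simp [hx, h0]
    · rw [hx]
      field_simp
  -- With `∇φ = -E`, the weak Poisson equation is Gauss's law with both sides negated.
  · simp only [inner_neg_left, neg_mul]
    rw [MeasureTheory.integral_neg, MeasureTheory.integral_neg, z.2.1.2.2 η hη]
    ring
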